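/- Let $(\alpha,\beta)\in\{(4,8),(8,4)\}$, and call $x,y\in\mathbb{Z}^2$ $4$-adjacent if $|x_1-y_1|+|x_2-y_2|=1$ and $8$-adjacent if $\max\{|x_1-y_1|,|x_2-y_2|\}=1$. A binary image is a map $I$ from a subset of $\mathbb{Z}^2$ to $\{\text{black},\text{white}\}$; its graph $I_\alpha$ has the domain of $I$ as vertex set and joins white pixels that are $\alpha$-adjacent and black pixels that are $\beta$-adjacent. A white $\alpha$-connected component of $I$ is a maximal nonempty set of white pixels that induces a connected subgraph of $I_\alpha$. For a finite nonempty $\alpha$-connected set $T\subset\mathbb{Z}^2$ define: - the site perimeter $P_\alpha(T)$, the set of points of $\mathbb{Z}^2\setminus T$ that are $\alpha$-adjacent to a point of $T$; - $G_\alpha(T)$, the graph $J_\alpha$ of the image $J$ on $\mathbb{Z}^2$ whose black pixels are exactly those of $P_\alpha(T)$; - $E_\alpha(T)$, the unique infinite white $\alpha$-connected component of $G_\alpha(T)$; - $P_\alpha^{ext}(T)$, the subgraph of $G_\alpha(T)$ induced by the points of $P_\alpha(T)$ that are $\alpha$-adjacent to a point of $E_\alpha(T)$ (it is a simple cycle,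 hence its straight-line embedding in $\mathbb{R}^2$ is a simple polygon); - $V_\alpha(T)\subset\mathbb{R}^2$, the open region enclosed by this polygon, i.e. the union of the bounded connected components of the complement of the embedding of $P_\alpha^{ext}(T)$, and $Z_\alpha(T):=V_\alpha(T)\cap\mathbb{Z}^2$; - the polygonal tile $$\mathscr{P}_\alpha(T):=V_\alpha(T)\setminus\bigcup_{\tau\in\mathcal{M}}V_\alpha(\tau),$$ where $\mathcal{M}$ is the set of all (vertex sets of) white $\alpha$-connected subgraphs of $G_\alpha(T)$ contained in $Z_\alpha(T)\setminus T$. Then for any two distinct finite white $\alpha$-connected components $T_1,T_2$ of a binary image, $$\mathscr{P}_\alpha(T_1)\cap\mathscr{P}_\alpha(T_2)=\emptyset.$$ -/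

import Mathlib

/-- The two notions of connectivity on `ℤ²`. -/
inductive Connectivity where
  | four
  | eight

/-- The dual notion of connectivity: `4 ↔ 8`. -/
def Connectivity.dual : Connectivity → Connectivity
  | .four => .eight
  | .eight => .four

/-- `d_4` is the `ℓ₁` metric on `ℤ²` and `d_8` is the `ℓ_∞` metric. -/
def pixelDist : Connectivity → ℤ × ℤ → ℤ × ℤ → ℤ
  | .four, x, y => |x.1 - y.1| + |x.2 - y.2|
  | .eight, x, y => max |x.1 - y.1| |x.2 - y.2|

/-- Two pixels are `α`-adjacent if their `d_α`-distance is `1`. -/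
def PixelAdj (α : Connectivity) (x y : ℤ × ℤ) : Prop :=
  pixelDist α x y = 1

theorem PixelAdj.symm {α : Connectivity} {x y : ℤ × ℤ} (h : PixelAdj α x y) :
    PixelAdj α y x := by
  cases α <;> simpa only [PixelAdj, pixelDist, abs_sub_comm] using h

theorem PixelAdj.ne {α : Connectivity} {x y : ℤ × ℤ} (h : PixelAdj α x y) : x ≠ y := by
  rintro rfl
  cases α <;> simp [PixelAdj, pixelDist] at h

inductive PixelColor where
  | black
  | white

/-- A binary image: a map from a subset of `ℤ²` to `{black, white}`. -/
structure BinaryImage where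
  domain : Set (ℤ × ℤ)
  color : domain → PixelColor

namespace BinaryImage

/-- The set of pixels of a given color. -/
def pixels (I : BinaryImage) (c : PixelColor) : Set (ℤ × ℤ) :=
  {z | ∃ h : z ∈ I.domain, I.color ⟨z, h⟩ = c}

/-- The graph `I_α`: white pixels are joined when `α`-adjacent, black pixels when adjacent for the
dual connectivity. Points outside the domain are neither white nor black and have no edges. -/
def graph (I : BinaryImage) (α : Connectivity) : SimpleGraph (ℤ × ℤ) where
  Adj x y :=
    (x ∈ I.pixels .white ∧ y ∈ I.pixels .white ∧ PixelAdj α x y) ∨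
      (x ∈ I.pixels .black ∧ y ∈ I.pixels .black ∧ PixelAdj α.dual x y)
  symm := ⟨fun _ _ h => h.imp (fun h => ⟨h.2.1, h.1, h.2.2.symm⟩) (fun h => ⟨h.2.1, h.1, h.2.2.symm⟩)⟩
  loopless := ⟨fun _ h => h.elim (fun h => h.2.2.ne rfl) (fun h => h.2.2.ne rfl)⟩

/-- The (nonempty) vertex sets of white `α`-connected subgraphs of `I_α`. -/
def IsWhiteConnected (I : BinaryImage) (α : Connectivity) (S : Set (ℤ × ℤ)) : Prop :=
  S ⊆ I.pixels .white ∧ ((I.graph α).induce S).Connected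

/-- White `α`-connected components: the maximal white `α`-connected sets of pixels. -/
def IsWhiteComponent (I : BinaryImage) (α : Connectivity) (T : Set (ℤ × ℤ)) : Prop :=
  Maximal (I.IsWhiteConnected α) T

end BinaryImage

/-- The site perimeter `P_α(T)`: the pixels outside `T` that are `α`-adjacent to `T`. -/
def sitePerimeter (α : Connectivity) (T : Set (ℤ × ℤ)) : Set (ℤ × ℤ) :=
  {z | z ∉ T ∧ ∃ t ∈ T, PixelAdj α z t}

open Classical in
/-- The image on all of `ℤ²` whose black pixels are exactly those of `P_α(T)`. -/
noncomputable def charImage (α : Connectivity) (T : Set (ℤ × ℤ)) : BinaryImage where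
  domain := Set.univ
  color z := if (z : ℤ × ℤ) ∈ sitePerimeter α T then .black else .white

/-- The characteristic graph `G_α(T)` of the site perimeter of `T`. -/
noncomputable def charGraph (α : Connectivity) (T : Set (ℤ × ℤ)) : SimpleGraph (ℤ × ℤ) :=
  (charImage α T).graph α

/-- `E_α(T)`: the infinite white `α`-connected component of `G_α(T)`. It is written as the union of
all such components; for finite `T` there is exactly one. -/
def exteriorRegion (α : Connectivity) (T : Set (ℤ × ℤ)) : Set (ℤ × ℤ) :=
  ⋃₀ {C | (charImage α T).IsWhiteComponent α C ∧ C.Infinite}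

/-- The vertices of the exterior site perimeter `P_α^ext(T)`. -/
def exteriorSitePerimeter (α : Connectivity) (T : Set (ℤ × ℤ)) : Set (ℤ × ℤ) :=
  {z | z ∈ sitePerimeter α T ∧ ∃ e ∈ exteriorRegion α T, PixelAdj α z e}

/-- The inclusion of `ℤ²` in `ℝ²`. -/
def toPlane (z : ℤ × ℤ) : ℝ × ℝ := ((z.1 : ℝ), (z.2 : ℝ))

/-- The straight-line embedding in `ℝ²` of the subgraph of `G` induced by `S`. -/
def graphEmbedding (G : SimpleGraph (ℤ × ℤ)) (S : Set (ℤ × ℤ)) : Set (ℝ × ℝ) :=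
  toPlane '' S ∪
    {x | ∃ u ∈ S, ∃ v ∈ S, G.Adj u v ∧ x ∈ segment ℝ (toPlane u) (toPlane v)}

/-- The polygonal curve in `ℝ²` given by the subgraph of `G_α(T)` induced by `P_α^ext(T)`. -/
def boundaryPolygon (α : Connectivity) (T : Set (ℤ × ℤ)) : Set (ℝ × ℝ) :=
  graphEmbedding (charGraph α T) (exteriorSitePerimeter α T)

/-- `V_α(T)`: the open region enclosed by the polygon `P_α^ext(T)`, that is, the points off the
polygon whose connected component in the complement of the polygon is bounded. -/
def polygonRegion (α : Connectivity) (T : Set (ℤ × ℤ)) : Set (ℝ × ℝ) :=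
  {x | x ∉ boundaryPolygon α T ∧
    Bornology.IsBounded (connectedComponentIn (boundaryPolygon α T)ᶜ x)}

/-- `Z_α(T) = V_α(T) ∩ ℤ²`. -/
def latticeRegion (α : Connectivity) (T : Set (ℤ × ℤ)) : Set (ℤ × ℤ) :=
  toPlane ⁻¹' polygonRegion α T

/-- The family `ℳ` of white `α`-connected subgraphs of `G_α(T)` contained in `Z_α(T) \ T`. -/
def nestedFamily (α : Connectivity) (T : Set (ℤ × ℤ)) : Set (Set (ℤ × ℤ)) :=
  {τ | (charImage α T).IsWhiteConnected α τ ∧ τ ⊆ latticeRegion α T \ T}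

/-- The polygonal tile of `T`, as a subset of `ℝ²`. -/
def polygonalTile (α : Connectivity) (T : Set (ℤ × ℤ)) : Set (ℝ × ℝ) :=
  polygonRegion α T \ ⋃ τ ∈ nestedFamily α T, polygonRegion α τ

/-!
Since `T` is finite and `α`-connected while every pixel of `E_α(T)` is joined to infinity inside
`E_α(T)`, counting ray crossings modulo `2` shows that `P_α^ext(T)` contains at most two corners of
a unit square if `α = 4`, and at most three if `α = 8`. Hence every point off the polygon sees a
nearby pixel that is not a vertex of it. The points seeing an interior pixel and those seeing an
exterior pixel form two disjoint open sets, and the former is `V_α(T)`.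

If one of the two components is not exterior to the other, it belongs to the family `ℳ` of the
other, and its region is removed there. If each is exterior to the other, a point of
`V_α(T₁) ∩ V_α(T₂)` sees a pixel enclosed by both polygons. The connected component of that pixel
among all such pixels belongs to `ℳ` for `T₁`, and its polygon is contained in that of `T₁`; so it
encloses the point, which is therefore not in the tile of `T₁`.
-/

/-! ### Adjacency and connectivity of pixels -/

theorem pixelAdj_four_iff {x y : ℤ × ℤ} : PixelAdj .four x y ↔
    (x.1 = y.1 ∧ (x.2 = y.2 + 1 ∨ y.2 = x.2 + 1)) ∨
      (x.2 = y.2 ∧ (x.1 = y.1 + 1 ∨ y.1 = x.1 + 1)) := by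
  simp only [PixelAdj, pixelDist]
  grind

theorem pixelAdj_eight_iff {x y : ℤ × ℤ} : PixelAdj .eight x y ↔
    x ≠ y ∧ |x.1 - y.1| ≤ 1 ∧ |x.2 - y.2| ≤ 1 := by
  simp only [PixelAdj, pixelDist, ne_eq, Prod.ext_iff]
  grind

theorem PixelAdj.of_four {α : Connectivity} {x y : ℤ × ℤ} (h : PixelAdj .four x y) :
    PixelAdj α x y := by
  cases α
  · exact h
  · simp only [PixelAdj, pixelDist] at h ⊢
    grind

theorem PixelAdj.to_eight {α : Connectivity} {x y : ℤ × ℤ} (h : PixelAdj α x y) :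
    PixelAdj .eight x y := by
  cases α
  · exact h.of_four
  · exact h

theorem PixelAdj.of_add_eq_add {α : Connectivity} {u v q q' : ℤ × ℤ} (huv : PixelAdj α u v)
    (hqq' : PixelAdj α q q') (hsum : u + v = q + q') (hne : u ≠ q) : PixelAdj α u q := by
  simp only [Prod.ext_iff, Prod.fst_add, Prod.snd_add, ne_eq] at hsum hne
  cases α
  · rw [pixelAdj_four_iff] at *
    omega
  · simp only [pixelAdj_eight_iff, ne_eq, Prod.ext_iff, abs_le] at *
    omega

/-- The graph of `α`-adjacency between the pixels of `S`. The pixels outside `S` are kept as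
isolated vertices, so that graphs for different `S` share their vertex type. -/
def pixelGraph (α : Connectivity) (S : Set (ℤ × ℤ)) : SimpleGraph (ℤ × ℤ) where
  Adj u v := u ∈ S ∧ v ∈ S ∧ PixelAdj α u v
  symm := ⟨fun _ _ h => ⟨h.2.1, h.1, h.2.2.symm⟩⟩
  loopless := ⟨fun _ h => h.2.2.ne rfl⟩

/-- Any two pixels of `S` are joined by an `α`-path in `S`. -/
def PixelConnected (α : Connectivity) (S : Set (ℤ × ℤ)) : Prop :=
  ∀ u ∈ S, ∀ v ∈ S, (pixelGraph α S).Reachable u v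

section PixelGraph

variable {α : Connectivity} {S S' : Set (ℤ × ℤ)} {u v : ℤ × ℤ}

theorem pixelGraph_mono (h : S ⊆ S') : pixelGraph α S ≤ pixelGraph α S' :=
  fun _ _ huv => ⟨h huv.1, h huv.2.1, huv.2.2⟩

theorem reachable_pixelGraph_induction {p : ℤ × ℤ → Prop} (h : (pixelGraph α S).Reachable u v)
    (hu : p u) (hstep : ∀ a ∈ S, ∀ b ∈ S, PixelAdj α a b → p a → p b) : p v := by
  rw [SimpleGraph.reachable_iff_reflTransGen] at h
  induction h with
  | refl => exact hu
  | tail _ hab ih => exact hstep _ hab.1 _ hab.2.1 hab.2.2 ih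

theorem mem_of_reachable_pixelGraph (h : (pixelGraph α S).Reachable u v) (hu : u ∈ S) : v ∈ S :=
  reachable_pixelGraph_induction h hu fun _ _ _ hb _ _ => hb

theorem reachable_pixelGraph_component (h : (pixelGraph α S).Reachable u v) :
    (pixelGraph α {w | (pixelGraph α S).Reachable u w}).Reachable u v := by
  rw [SimpleGraph.reachable_iff_reflTransGen] at h
  induction h with
  | refl => exact .rfl
  | tail hs hab ih =>
    have ha := (SimpleGraph.reachable_iff_reflTransGen ..).2 hs
    exact ih.trans (SimpleGraph.Adj.reachable ⟨ha, ha.trans hab.reachable, hab.2.2⟩)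

theorem pixelConnected_component (α : Connectivity) (S : Set (ℤ × ℤ)) (u : ℤ × ℤ) :
    PixelConnected α {w | (pixelGraph α S).Reachable u w} := fun _ hv _ hw =>
  (reachable_pixelGraph_component hv).symm.trans (reachable_pixelGraph_component hw)

end PixelGraph

namespace BinaryImage

variable {α : Connectivity} {I : BinaryImage} {S S' : Set (ℤ × ℤ)} {u v : ℤ × ℤ}

theorem disjoint_pixels_white_black : Disjoint (I.pixels .white) (I.pixels .black) := by
  rw [Set.disjoint_left]
  rintro u ⟨_, hwhite⟩ ⟨_, hblack⟩
  cases hwhite.symm.trans hblack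

theorem induce_graph_eq_of_subset_white (hS : S ⊆ I.pixels .white) :
    (I.graph α).induce S = (pixelGraph α S).induce S := by
  ext ⟨u, hu⟩ ⟨v, hv⟩
  have hnot : u ∉ I.pixels .black := Set.disjoint_left.1 disjoint_pixels_white_black (hS hu)
  simp [graph, pixelGraph, hu, hv, hS hu, hS hv, hnot]

theorem isWhiteConnected_iff :
    I.IsWhiteConnected α S ↔ S ⊆ I.pixels .white ∧ S.Nonempty ∧ PixelConnected α S := by
  refine and_congr_right fun hS => ?_
  rw [induce_graph_eq_of_subset_white hS, SimpleGraph.connected_iff, and_comm,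
    Set.nonempty_coe_sort]
  refine and_congr_right fun _ => ⟨fun h u hu v hv => ?_, ?_⟩
  · exact (h ⟨u, hu⟩ ⟨v, hv⟩).map (SimpleGraph.Embedding.induce S).toHom
  · rintro h ⟨u, hu⟩ ⟨v, hv⟩
    obtain ⟨p⟩ := h u hu v hv
    exact ⟨p.induce S fun w hw => mem_of_reachable_pixelGraph ⟨p.takeUntil w hw⟩ hu⟩

theorem isWhiteComponent_reachable (hu : u ∈ I.pixels .white) :
    I.IsWhiteComponent α {w | (pixelGraph α (I.pixels .white)).Reachable u w} := by
  refine ⟨isWhiteConnected_iff.2 ⟨fun w hw => mem_of_reachable_pixelGraph hw hu, ⟨u, .rfl⟩,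
    pixelConnected_component _ _ _⟩, fun C hC hle c hc => ?_⟩
  obtain ⟨hwhite, -, hconn⟩ := isWhiteConnected_iff.1 hC
  exact (hconn u (hle .rfl) c hc).mono (pixelGraph_mono hwhite)

theorem IsWhiteComponent.eq_reachable (hS : I.IsWhiteComponent α S) (hu : u ∈ S) :
    S = {w | (pixelGraph α (I.pixels .white)).Reachable u w} := by
  obtain ⟨hwhite, -, hconn⟩ := isWhiteConnected_iff.1 hS.prop
  exact hS.eq_of_le (isWhiteComponent_reachable (hwhite hu)).prop
    fun c hc => (hconn u hu c hc).mono (pixelGraph_mono hwhite)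

theorem IsWhiteComponent.mem_of_adj (hS : I.IsWhiteComponent α S) (hu : u ∈ S)
    (hv : v ∈ I.pixels .white) (huv : PixelAdj α u v) : v ∈ S := by
  rw [hS.eq_reachable hu]
  exact SimpleGraph.Adj.reachable ⟨hS.prop.1 hu, hv, huv⟩

theorem IsWhiteComponent.disjoint_of_ne (hS : I.IsWhiteComponent α S)
    (hS' : I.IsWhiteComponent α S') (hne : S ≠ S') : Disjoint S S' := by
  rw [Set.disjoint_left]
  intro u hu hu'
  exact hne ((hS.eq_reachable hu).trans (hS'.eq_reachable hu').symm)

end BinaryImage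

/-! ### Exterior and interior pixels -/

/-- The pixels enclosed by `P_α^ext(T)`; for finite connected `T` this is `Z_α(T)`. -/
def interiorPixels (α : Connectivity) (T : Set (ℤ × ℤ)) : Set (ℤ × ℤ) :=
  (exteriorRegion α T ∪ exteriorSitePerimeter α T)ᶜ

section Exterior

variable {α : Connectivity} {S T : Set (ℤ × ℤ)} {u v z : ℤ × ℤ}

theorem white_charImage : (charImage α T).pixels .white = (sitePerimeter α T)ᶜ := by
  ext z
  simp [BinaryImage.pixels, charImage]

theorem black_charImage : (charImage α T).pixels .black = sitePerimeter α T := by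
  ext z
  simp [BinaryImage.pixels, charImage]

theorem mem_exteriorRegion : z ∈ exteriorRegion α T ↔ z ∉ sitePerimeter α T ∧
    {w | (pixelGraph α (sitePerimeter α T)ᶜ).Reachable z w}.Infinite := by
  rw [← Set.mem_compl_iff, ← white_charImage]
  constructor
  · rintro ⟨C, ⟨hC, hinf⟩, hz⟩
    exact ⟨hC.prop.1 hz, hC.eq_reachable hz ▸ hinf⟩
  · rintro ⟨hwhite, hinf⟩
    exact ⟨_, ⟨BinaryImage.isWhiteComponent_reachable hwhite, hinf⟩, .rfl⟩

theorem mem_exteriorRegion_of_reachable (hu : u ∈ exteriorRegion α T)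
    (h : (pixelGraph α (sitePerimeter α T)ᶜ).Reachable u v) : v ∈ exteriorRegion α T := by
  obtain ⟨hperim, hinf⟩ := mem_exteriorRegion.1 hu
  exact mem_exteriorRegion.2
    ⟨mem_of_reachable_pixelGraph h hperim, hinf.mono fun w hw => h.symm.trans hw⟩

theorem infinite_reachable_exteriorRegion (hu : u ∈ exteriorRegion α T) :
    {w | (pixelGraph α (exteriorRegion α T)).Reachable u w}.Infinite :=
  (mem_exteriorRegion.1 hu).2.mono fun _ hw => (reachable_pixelGraph_component hw).mono
    (pixelGraph_mono fun _ hv => mem_exteriorRegion_of_reachable hu hv)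

theorem mem_exteriorRegion_of_adj (hu : u ∈ exteriorRegion α T) (huv : PixelAdj α u v)
    (hv : v ∉ sitePerimeter α T) : v ∈ exteriorRegion α T :=
  mem_exteriorRegion_of_reachable hu
    (SimpleGraph.Adj.reachable ⟨(mem_exteriorRegion.1 hu).1, hv, huv⟩)

theorem disjoint_exteriorRegion_self (hT : T.Finite) : Disjoint T (exteriorRegion α T) := by
  refine Set.disjoint_left.2 fun z hz hzE => (mem_exteriorRegion.1 hzE).2 (hT.subset fun w hw => ?_)
  refine reachable_pixelGraph_induction hw hz fun a _ b hb hab ha => ?_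
  by_contra hbT
  exact hb ⟨hbT, a, ha, hab.symm⟩

theorem not_pixelAdj_exteriorRegion (hT : T.Finite) (hu : u ∈ T) (hv : v ∈ exteriorRegion α T) :
    ¬PixelAdj α u v := fun huv =>
  (mem_exteriorRegion.1 hv).1
    ⟨fun hvT => Set.disjoint_left.1 (disjoint_exteriorRegion_self hT) hvT hv, u, hu, huv.symm⟩

theorem PixelConnected.disjoint_exteriorRegion (hS : PixelConnected α S)
    (hd : Disjoint S (sitePerimeter α T)) (h : ¬S ⊆ exteriorRegion α T) :
    Disjoint S (exteriorRegion α T) := by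
  refine Set.disjoint_left.2 fun u hu huE => h fun v hv => ?_
  exact mem_exteriorRegion_of_reachable huE
    ((hS u hu v hv).mono (pixelGraph_mono (Set.subset_compl_iff_disjoint_right.2 hd)))

theorem mem_exteriorRegion_of_injective {f : ℤ → ℤ × ℤ} (hf : Function.Injective f)
    (hadj : ∀ k, PixelAdj α (f k) (f (k + 1))) (hP : ∀ k, f k ∉ sitePerimeter α T) :
    f 0 ∈ exteriorRegion α T := by
  have hstep (k : ℤ) : (pixelGraph α (sitePerimeter α T)ᶜ).Reachable (f k) (f (k + 1)) :=
    SimpleGraph.Adj.reachable ⟨hP k, hP (k + 1), hadj k⟩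
  refine mem_exteriorRegion.2 ⟨hP 0, (Set.infinite_range_of_injective hf).mono ?_⟩
  rintro _ ⟨k, rfl⟩
  induction k using Int.induction_on with
  | zero => exact .rfl
  | succ k ih => exact ih.trans (hstep k)
  | pred k ih => exact ih.trans (by simpa using (hstep (-k - 1)).symm)

theorem exists_abs_le_of_finite (hS : S.Finite) : ∃ N : ℤ, ∀ z ∈ S, |z.1| ≤ N ∧ |z.2| ≤ N := by
  obtain ⟨N, hN⟩ := (hS.image fun z : ℤ × ℤ => max |z.1| |z.2|).bddAbove
  exact ⟨N, fun z hz => max_le_iff.1 (hN ⟨z, hz, rfl⟩)⟩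

theorem finite_of_abs_le {N : ℤ} (h : ∀ z ∈ S, |z.1| ≤ N ∧ |z.2| ≤ N) : S.Finite :=
  ((Set.finite_Icc (-N) N).prod (Set.finite_Icc (-N) N)).subset
    fun z hz => ⟨abs_le.1 (h z hz).1, abs_le.1 (h z hz).2⟩

theorem finite_sitePerimeter (hT : T.Finite) : (sitePerimeter α T).Finite := by
  obtain ⟨N, hN⟩ := exists_abs_le_of_finite hT
  refine finite_of_abs_le (N := N + 1) ?_
  rintro z ⟨-, t, ht, hzt⟩
  have := (pixelAdj_eight_iff.1 hzt.to_eight).2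
  have := hN t ht
  grind

/-- A pixel far away lies on a horizontal or a vertical line that misses the site perimeter. -/
theorem finite_compl_exteriorRegion (hT : T.Finite) : (exteriorRegion α T)ᶜ.Finite := by
  obtain ⟨N, hN⟩ := exists_abs_le_of_finite (finite_sitePerimeter (α := α) hT)
  refine finite_of_abs_le (N := N) fun z hz => ?_
  by_contra! hfar
  refine hz ?_
  by_cases hz₁ : |z.1| ≤ N
  · convert mem_exteriorRegion_of_injective (f := fun k => (z.1 + k, z.2)) ?_ ?_ ?_
    · simp
    · exact fun a b hab => by simpa using hab
    · exact fun k => .of_four (pixelAdj_four_iff.2 (by simp [add_assoc]))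
    · exact fun k hk => (hfar hz₁).not_ge (hN _ hk).2
  · convert mem_exteriorRegion_of_injective (f := fun k => (z.1, z.2 + k)) ?_ ?_ ?_
    · simp
    · exact fun a b hab => by simpa using hab
    · exact fun k => .of_four (pixelAdj_four_iff.2 (by simp [add_assoc]))
    · exact fun k hk => hz₁ (hN _ hk).1

theorem finite_interiorPixels (hT : T.Finite) : (interiorPixels α T).Finite :=
  (finite_compl_exteriorRegion hT).subset (Set.compl_subset_compl.2 Set.subset_union_left)

theorem subset_interiorPixels (hT : T.Finite) : T ⊆ interiorPixels α T := fun _ hz hor =>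
  hor.elim (Set.disjoint_left.1 (disjoint_exteriorRegion_self hT) hz) fun h => h.1.1 hz

theorem notMem_interiorPixels_of_adj (hu : u ∈ exteriorRegion α T) (huv : PixelAdj α u v) :
    v ∉ interiorPixels α T := by
  refine fun hv => hv ?_
  by_cases hvP : v ∈ sitePerimeter α T
  · exact Or.inr ⟨hvP, u, hu, huv.symm⟩
  · exact Or.inl (mem_exteriorRegion_of_adj hu huv hvP)

theorem mem_exteriorSitePerimeter_of_adj (hu : u ∈ interiorPixels α T) (huv : PixelAdj α u v)
    (hv : v ∉ interiorPixels α T) : v ∈ exteriorSitePerimeter α T :=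
  (not_not.1 hv).resolve_left fun hvE => notMem_interiorPixels_of_adj hvE huv.symm hu

end Exterior

/-! ### Planarity of the pixel grid -/

/-- The edges `uv` and `qq'` of the king graph do not meet in the plane: they share no vertex and
are not the two diagonals of a unit square. -/
def Noncrossing (u v q q' : ℤ × ℤ) : Prop :=
  u ≠ q ∧ u ≠ q' ∧ v ≠ q ∧ v ≠ q' ∧ u + v ≠ q + q'

/-- The indicator of the open vertical ray going up from `q`. -/
def rayIndicator (q w : ℤ × ℤ) : ZMod 2 :=
  if w.1 = q.1 ∧ q.2 < w.2 then 1 else 0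

/-- Whether the edge `uv` leaves the vertical ray above `q` to the right, in which case it crosses
the translate of that ray by a small amount to the right. -/
def rayCrossing (q u v : ℤ × ℤ) : ZMod 2 :=
  (if v.1 = q.1 + 1 then rayIndicator q u else 0) + if u.1 = q.1 + 1 then rayIndicator q v else 0

/-- The indicator whose coboundary is the change of `rayCrossing` from `q` to a neighbour `q'`:
the ray above the right-hand one of the two. -/
def stepIndicator (q q' w : ℤ × ℤ) : ZMod 2 :=
  if q.1 < q'.1 then rayIndicator q' w else if q'.1 < q.1 then rayIndicator q w else 0

/-- The sum of `φ` over the edges of a walk, modulo `2`. -/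
def dartSum {V : Type*} {G : SimpleGraph V} (φ : V → V → ZMod 2) {u v : V} (p : G.Walk u v) :
    ZMod 2 :=
  (p.darts.map fun d => φ d.fst d.snd).sum

section DartSum

variable {V : Type*} {G G' : SimpleGraph V} {φ ψ : V → V → ZMod 2} {τ : V → ZMod 2} {t u v : V}

theorem dartSum_add (p : G.Walk u v) :
    dartSum (fun a b => φ a b + ψ a b) p = dartSum φ p + dartSum ψ p :=
  List.sum_map_add

theorem dartSum_eq_of_coboundary (hφ : ∀ a b, G.Adj a b → φ a b = τ a + τ b) (p : G.Walk u v) :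
    dartSum φ p = τ u + τ v := by
  induction p with
  | nil => simp [dartSum, CharTwo.add_self_eq_zero]
  | @cons a b c hab p ih =>
    calc dartSum φ (p.cons hab) = φ a b + dartSum φ p := by simp [dartSum]
      _ = τ a + τ c + (τ b + τ b) := by rw [ih, hφ a b hab]; ring
      _ = τ a + τ c := by rw [CharTwo.add_self_eq_zero, add_zero]

theorem dartSum_loop_eq_zero (p : G.Walk t u) (p' : G'.Walk t v)
    (hG : ∀ a b, G.Adj a b → φ a b = τ a + τ b) (hG' : ∀ a b, G'.Adj a b → φ a b = τ a + τ b)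
    (huv : φ u v = τ u + τ v) : dartSum φ p + φ u v + dartSum φ p' = 0 := by
  rw [dartSum_eq_of_coboundary hG, dartSum_eq_of_coboundary hG', huv]
  calc τ t + τ u + (τ u + τ v) + (τ t + τ v)
      = τ t + τ t + (τ u + τ u) + (τ v + τ v) := by ring
    _ = 0 := by simp only [CharTwo.add_self_eq_zero]

end DartSum

section RayCrossing

variable {u v p q r q' t : ℤ × ℤ}

theorem rayCrossing_add_rayCrossing (huv : PixelAdj .eight u v) (hqq' : PixelAdj .eight q q')
    (h : Noncrossing u v q q') :
    rayCrossing q u v + rayCrossing q' u v = stepIndicator q q' u + stepIndicator q q' v := by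
  simp only [pixelAdj_eight_iff, Noncrossing, ne_eq, Prod.ext_iff, abs_le, Prod.fst_add,
    Prod.snd_add] at *
  simp only [rayCrossing, stepIndicator, rayIndicator]
  split_ifs <;> first | rfl | omega

theorem rayCrossing_eq_of_far {N : ℤ} (huv : PixelAdj .eight u v) (hu : |u.1| ≤ N ∧ |u.2| ≤ N)
    (hv : |v.1| ≤ N ∧ |v.2| ≤ N) (hq : ¬(|q.1| ≤ N ∧ |q.2| ≤ N)) :
    rayCrossing q u v = (if q.2 < -N ∧ u.1 ≤ q.1 then 1 else 0) +
      if q.2 < -N ∧ v.1 ≤ q.1 then 1 else 0 := by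
  simp only [pixelAdj_eight_iff, abs_le] at *
  simp only [rayCrossing, rayIndicator]
  split_ifs <;> first | rfl | omega

theorem sum_stepIndicator_triangle_eq_zero (hpq : PixelAdj .eight p q) (hqr : PixelAdj .eight q r)
    (hrp : PixelAdj .eight r p) (htp : t ≠ p) (htq : t ≠ q) (htr : t ≠ r) :
    stepIndicator q r t + stepIndicator r p t + stepIndicator p q t = 0 := by
  simp only [pixelAdj_eight_iff, ne_eq, Prod.ext_iff, abs_le] at *
  simp only [stepIndicator, rayIndicator]
  split_ifs <;> first | rfl | omega

theorem sum_rayCrossing_triangle_of_fst_eq (hpq : PixelAdj .eight p q) (hqr : PixelAdj .eight q r)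
    (hrp : PixelAdj .eight r p) (h : q.1 = r.1) :
    (stepIndicator q r p + rayCrossing p q r) + (stepIndicator r p q + rayCrossing q r p) +
      (stepIndicator p q r + rayCrossing r p q) = 1 := by
  simp only [pixelAdj_eight_iff, ne_eq, Prod.ext_iff, abs_le] at hpq hqr hrp
  obtain hp₁ | hp₁ : r.1 = p.1 + 1 ∨ p.1 = r.1 + 1 := by omega
  all_goals
    obtain hq₂ | hq₂ : q.2 = r.2 + 1 ∨ r.2 = q.2 + 1 := by omega
    all_goals
      obtain hp₂ | hp₂ : p.2 = q.2 ∨ p.2 = r.2 := by omega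
      all_goals
        simp [stepIndicator, rayCrossing, rayIndicator, h, hp₁, hq₂, hp₂, add_assoc]

theorem sum_rayCrossing_triangle_eq_one (hpq : PixelAdj .eight p q) (hqr : PixelAdj .eight q r)
    (hrp : PixelAdj .eight r p) :
    (stepIndicator q r p + rayCrossing p q r) + (stepIndicator r p q + rayCrossing q r p) +
      (stepIndicator p q r + rayCrossing r p q) = 1 := by
  obtain h | h | h : q.1 = r.1 ∨ r.1 = p.1 ∨ p.1 = q.1 := by
    simp only [pixelAdj_eight_iff, abs_le] at *
    omega
  · exact sum_rayCrossing_triangle_of_fst_eq hpq hqr hrp h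
  · rw [← sum_rayCrossing_triangle_of_fst_eq hqr hrp hpq h]
    ring
  · rw [← sum_rayCrossing_triangle_of_fst_eq hrp hpq hqr h]
    ring

end RayCrossing

/-- Every corner of the triangle `c` lies outside `X` and is `α`-adjacent to `X`; for `8`-adjacency
the fourth corner of the unit square containing `c` does not belong to `X` either. -/
structure TouchesTriangle (α : Connectivity) (X : Set (ℤ × ℤ)) (c : Fin 3 → ℤ × ℤ) : Prop where
  notMem : ∀ i, c i ∉ X
  exists_adj : ∀ i, ∃ x ∈ X, PixelAdj α (c i) x
  fourth_notMem : α = .eight → ∀ d, (∀ i, PixelAdj .eight d (c i)) → d ∉ X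

section Planarity

variable {α : Connectivity} {S E : Set (ℤ × ℤ)} {c : Fin 3 → ℤ × ℤ} {i j k : Fin 3}
  {u v q q' t : ℤ × ℤ}

theorem Noncrossing.symm (h : Noncrossing u v q q') : Noncrossing q q' u v :=
  ⟨h.1.symm, h.2.2.1.symm, h.2.1.symm, h.2.2.2.1.symm, h.2.2.2.2.symm⟩

theorem noncrossing_of_separated (hSE : Disjoint S E)
    (hadj : ∀ x ∈ S, ∀ y ∈ E, ¬PixelAdj α x y) (hc : Function.Injective c)
    (hcS : ∀ i, c i ∉ S) (hcE : ∀ i, c i ∉ E) (hik : i ≠ k)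
    (huv : (pixelGraph α (insert (c i) S)).Adj u v)
    (hqq' : (pixelGraph α (insert (c k) E)).Adj q q') : Noncrossing u v q q' := by
  obtain ⟨hu, hv, huv⟩ := huv
  obtain ⟨hq, hq', hqq'⟩ := hqq'
  have hne : ∀ x ∈ insert (c i) S, ∀ y ∈ insert (c k) E, x ≠ y := by
    rintro x (rfl | hx) y (rfl | hy) hxy
    · exact hik (hc hxy)
    · exact hcE i (hxy ▸ hy)
    · exact hcS k (hxy ▸ hx)
    · exact Set.disjoint_left.1 hSE hx (hxy ▸ hy)
  have hS : ∃ x ∈ S, x = u ∨ x = v := by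
    rcases hu with rfl | hu
    · exact ⟨v, hv.resolve_left huv.ne.symm, .inr rfl⟩
    · exact ⟨u, hu, .inl rfl⟩
  have hE : ∃ y ∈ E, y = q ∨ y = q' := by
    rcases hq with rfl | hq
    · exact ⟨q', hq'.resolve_left hqq'.ne.symm, .inr rfl⟩
    · exact ⟨q, hq, .inl rfl⟩
  refine ⟨hne _ hu _ hq, hne _ hu _ hq', hne _ hv _ hq, hne _ hv _ hq', fun hsum => ?_⟩
  obtain ⟨x, hx, hx'⟩ := hS
  obtain ⟨y, hy, hy'⟩ := hE
  refine hadj x hx y hy ?_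
  have hsum' : v + u = q + q' := (add_comm v u).trans hsum
  rcases hx' with rfl | rfl <;> rcases hy' with rfl | rfl
  · exact huv.of_add_eq_add hqq' hsum (hne _ hu _ hq)
  · exact huv.of_add_eq_add hqq'.symm (hsum.trans (add_comm _ _)) (hne _ hu _ hq')
  · exact huv.symm.of_add_eq_add hqq' hsum' (hne _ hv _ hq)
  · exact huv.symm.of_add_eq_add hqq'.symm (hsum'.trans (add_comm _ _)) (hne _ hv _ hq')

theorem eq_or_eq_of_crossing {p q r : ℤ × ℤ} (hpq : PixelAdj .eight p q)
    (hqr : PixelAdj .eight q r) (hrp : PixelAdj .eight r p) (huv : PixelAdj α u v) (hup : u ≠ p)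
    (huq : u ≠ q) (hsum : u + v = p + q) : α = .eight ∧ (u = r ∨ v = r) := by
  cases α <;>
    simp only [pixelAdj_four_iff, pixelAdj_eight_iff, ne_eq, Prod.ext_iff, abs_le, Prod.fst_add,
      Prod.snd_add, true_and, reduceCtorEq, false_and] at * <;>
    omega

theorem TouchesTriangle.noncrossing {X : Set (ℤ × ℤ)} (hX : TouchesTriangle α X c)
    (hc : Pairwise fun i j => PixelAdj .eight (c i) (c j)) (hij : i ≠ j) (hjk : j ≠ k)
    (hki : k ≠ i) (huv : (pixelGraph α (insert (c k) X)).Adj u v) :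
    Noncrossing u v (c i) (c j) := by
  obtain ⟨hu, hv, huv⟩ := huv
  have hne : ∀ x ∈ insert (c k) X, x ≠ c i ∧ x ≠ c j := by
    rintro x (rfl | hx)
    · exact ⟨(hc hki).ne, (hc hjk).ne.symm⟩
    · exact ⟨ne_of_mem_of_not_mem hx (hX.notMem i), ne_of_mem_of_not_mem hx (hX.notMem j)⟩
  refine ⟨(hne u hu).1, (hne u hu).2, (hne v hv).1, (hne v hv).2, fun hsum => ?_⟩
  have hnot : ∀ x ∈ insert (c k) X, PixelAdj α x (c k) → x + c k = c i + c j → α ≠ .eight := by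
    intro x hx hxk hsum hα
    refine hX.fourth_notMem hα x (fun m => ?_) (hx.resolve_left hxk.ne)
    obtain rfl | rfl | rfl : m = i ∨ m = j ∨ m = k := by omega
    · exact hxk.to_eight.of_add_eq_add (hc hij) hsum (hne x hx).1
    · exact hxk.to_eight.of_add_eq_add (hc hij.symm) (hsum.trans (add_comm _ _)) (hne x hx).2
    · exact hxk.to_eight
  obtain ⟨hα, rfl | rfl⟩ := eq_or_eq_of_crossing (hc hij) (hc hjk) (hc hki) huv (hne u hu).1
    (hne u hu).2 hsum
  · exact hnot v hv huv.symm ((add_comm _ _).trans hsum) hα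
  · exact hnot u hu huv hsum hα

theorem exists_reachable_insert_far {e : ℤ × ℤ} (he : e ∈ E)
    (hinf : {w | (pixelGraph α E).Reachable e w}.Infinite) (hve : PixelAdj α v e) (N : ℤ) :
    ∃ w, (pixelGraph α (insert v E)).Reachable w v ∧ ¬(|w.1| ≤ N ∧ |w.2| ≤ N) := by
  obtain ⟨w, hw, hfar⟩ : ∃ w, (pixelGraph α E).Reachable e w ∧ ¬(|w.1| ≤ N ∧ |w.2| ≤ N) := by
    by_contra! h
    exact hinf (finite_of_abs_le h)
  exact ⟨w, (hw.mono (pixelGraph_mono (Set.subset_insert _ _))).symm.trans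
    (SimpleGraph.Adj.reachable ⟨.inr he, .inl rfl, hve.symm⟩), hfar⟩

theorem loop_crossings_eq_zero (hS : S.Finite) (hSE : Disjoint S E)
    (hadj : ∀ x ∈ S, ∀ y ∈ E, ¬PixelAdj α x y)
    (hE : ∀ e ∈ E, {w | (pixelGraph α E).Reachable e w}.Infinite)
    (hc : Pairwise fun i j => PixelAdj .eight (c i) (c j)) (hcS : ∀ i, c i ∉ S)
    (hcE : TouchesTriangle α E c) (hij : i ≠ j) (hjk : j ≠ k) (hki : k ≠ i)
    (p : (pixelGraph α (insert (c i) S)).Walk t (c i))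
    (p' : (pixelGraph α (insert (c j) S)).Walk t (c j)) :
    dartSum (rayCrossing (c k)) p + rayCrossing (c k) (c i) (c j) +
      dartSum (rayCrossing (c k)) p' = 0 := by
  have hinj : Function.Injective c := fun a b hab => not_not.1 fun hne => (hc hne).ne hab
  obtain ⟨N, hN⟩ := exists_abs_le_of_finite (hS.union (Set.finite_range c))
  have hbox : ∀ m, ∀ x ∈ insert (c m) S, |x.1| ≤ N ∧ |x.2| ≤ N := by
    rintro m x (rfl | hx)
    · exact hN _ (.inr ⟨m, rfl⟩)
    · exact hN _ (.inl hx)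
  obtain ⟨e, he, hke⟩ := hcE.exists_adj k
  obtain ⟨w, hkw, hfar⟩ := exists_reachable_insert_far he (hE e he) hke N
  refine reachable_pixelGraph_induction (p := fun q => dartSum (rayCrossing q) p +
    rayCrossing q (c i) (c j) + dartSum (rayCrossing q) p' = 0) hkw ?_ ?_
  · exact dartSum_loop_eq_zero p p'
      (fun a b hab => rayCrossing_eq_of_far hab.2.2.to_eight
        (hbox i a hab.1) (hbox i b hab.2.1) hfar)
      (fun a b hab => rayCrossing_eq_of_far hab.2.2.to_eight
        (hbox j a hab.1) (hbox j b hab.2.1) hfar)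
      (rayCrossing_eq_of_far (hc hij) (hbox i _ (.inl rfl)) (hbox j _ (.inl rfl)) hfar)
  · intro q hq q' hq' hqq' hzero
    have hloop := dartSum_loop_eq_zero (φ := fun a b => rayCrossing q a b + rayCrossing q' a b)
      (τ := stepIndicator q q') p p'
      (fun a b hab => rayCrossing_add_rayCrossing hab.2.2.to_eight hqq'.to_eight
        (noncrossing_of_separated hSE hadj hinj hcS hcE.notMem hki.symm hab ⟨hq, hq', hqq'⟩))
      (fun a b hab => rayCrossing_add_rayCrossing hab.2.2.to_eight hqq'.to_eight
        (noncrossing_of_separated hSE hadj hinj hcS hcE.notMem hjk hab ⟨hq, hq', hqq'⟩))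
      (rayCrossing_add_rayCrossing (hc hij) hqq'.to_eight
        (hcE.noncrossing hc hij hjk hki ⟨hq, hq', hqq'⟩).symm)
    rw [dartSum_add, dartSum_add] at hloop
    linear_combination hloop - hzero

theorem crossings_add_crossings (hc : Pairwise fun i j => PixelAdj .eight (c i) (c j))
    (hcS : TouchesTriangle α S c) (hij : i ≠ j) (hjk : j ≠ k) (hki : k ≠ i)
    (p : (pixelGraph α (insert (c i) S)).Walk t (c i)) :
    dartSum (rayCrossing (c j)) p + dartSum (rayCrossing (c k)) p =
      stepIndicator (c j) (c k) t + stepIndicator (c j) (c k) (c i) := by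
  rw [← dartSum_add]
  refine dartSum_eq_of_coboundary (fun a b hab => ?_) p
  exact rayCrossing_add_rayCrossing hab.2.2.to_eight (hc hjk) (hcS.noncrossing hc hjk hki hij hab)

theorem PixelConnected.reachable_insert (hS : PixelConnected α S) (ht : t ∈ S)
    (hv : ∃ x ∈ S, PixelAdj α v x) : (pixelGraph α (insert v S)).Reachable t v := by
  obtain ⟨x, hx, hvx⟩ := hv
  exact ((hS t ht x hx).mono (pixelGraph_mono (Set.subset_insert _ _))).trans
    (SimpleGraph.Adj.reachable ⟨.inr hx, .inl rfl, hvx.symm⟩)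

/-- Join a pixel of `S` to the three corners by paths through `S`. Two of these paths and a side of
the triangle form a loop, which crosses the ray above the third corner an even number of times
because that corner is joined to infinity through `E`; but the three numbers have an odd sum. -/
theorem not_touchesTriangle (hS : S.Finite) (hSconn : PixelConnected α S) (hSE : Disjoint S E)
    (hadj : ∀ x ∈ S, ∀ y ∈ E, ¬PixelAdj α x y)
    (hE : ∀ e ∈ E, {w | (pixelGraph α E).Reachable e w}.Infinite)
    (hc : Pairwise fun i j => PixelAdj .eight (c i) (c j))
    (hcS : TouchesTriangle α S c) : ¬TouchesTriangle α E c := by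
  intro hcE
  obtain ⟨t, ht, -⟩ := hcS.exists_adj 0
  obtain ⟨p⟩ : Nonempty (∀ i, (pixelGraph α (insert (c i) S)).Walk t (c i)) :=
    Classical.nonempty_pi.2 fun i => hSconn.reachable_insert ht (hcS.exists_adj i)
  have htc : ∀ i, t ≠ c i := fun i => ne_of_mem_of_not_mem ht (hcS.notMem i)
  have h01 : (0 : Fin 3) ≠ 1 := by decide
  have h12 : (1 : Fin 3) ≠ 2 := by decide
  have h20 : (2 : Fin 3) ≠ 0 := by decide
  have loop {i j k} (hij hjk hki) := loop_crossings_eq_zero (i := i) (j := j) (k := k)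
    hS hSE hadj hE hc hcS.notMem hcE hij hjk hki (p i) (p j)
  have side {i j k} (hij hjk hki) := crossings_add_crossings (i := i) (j := j) (k := k)
    hc hcS hij hjk hki (p i)
  have hzero := sum_stepIndicator_triangle_eq_zero (hc h01) (hc h12) (hc h20)
    (htc 0) (htc 1) (htc 2)
  have hone := sum_rayCrossing_triangle_eq_one (hc h01) (hc h12) (hc h20)
  refine zero_ne_one (α := ZMod 2) ?_
  linear_combination hone + hzero - (loop h01 h12 h20 + loop h12 h20 h01 + loop h20 h01 h12)
    + side h01 h12 h20 + side h12 h20 h01 + side h20 h01 h12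

end Planarity

/-! ### Segments in unit squares -/

section Segments

variable {E : Type*} [AddCommGroup E] [Module ℝ E] [TopologicalSpace E] [IsTopologicalAddGroup E]
  [ContinuousSMul ℝ E] {F : Set E} {x y z : E}

theorem mem_connectedComponentIn_of_segment (hy : y ∈ connectedComponentIn F x)
    (hyz : segment ℝ y z ⊆ F) : z ∈ connectedComponentIn F x := by
  rw [connectedComponentIn_eq hy]
  exact (convex_segment y z).isPreconnected.subset_connectedComponentIn
    (left_mem_segment ℝ y z) hyz (right_mem_segment ℝ y z)

theorem isOpen_setOf_segment_subset (hF : IsOpen F) (z : E) : IsOpen {x | segment ℝ x z ⊆ F} := by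
  simp only [segment_eq_image, Set.image_subset_iff]
  refine isOpen_iff_mem_nhds.2 fun x hx =>
    isCompact_Icc.eventually_forall_of_forall_eventually fun t ht => ?_
  exact ContinuousAt.eventually_mem (by fun_prop) (hF.mem_nhds (hx ht))

theorem isCompact_segment (x y : E) : IsCompact (segment ℝ x y) := by
  rw [segment_eq_image]
  exact isCompact_Icc.image (by fun_prop)

end Segments

theorem mem_segment_prod_iff {x y w : ℝ × ℝ} : w ∈ segment ℝ x y ↔ ∃ t ∈ Set.Icc (0 : ℝ) 1,
    w.1 = x.1 + t * (y.1 - x.1) ∧ w.2 = x.2 + t * (y.2 - x.2) := by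
  simp only [segment_eq_image', Set.mem_image, Prod.ext_iff, Prod.fst_add, Prod.snd_add,
    Prod.smul_fst, Prod.smul_snd, Prod.fst_sub, Prod.snd_sub, smul_eq_mul, eq_comm]

theorem dist_toPlane_lt_one {x : ℝ × ℝ} {z : ℤ × ℤ} :
    dist x (toPlane z) < 1 ↔ |x.1 - z.1| < 1 ∧ |x.2 - z.2| < 1 := by
  rw [Prod.dist_eq, max_lt_iff, Real.dist_eq, Real.dist_eq]
  rfl

/-- The pixels `a` and `b` are the neighbours of `z` in a unit square with corner `z`; the corner
opposite to `z` is `a + b - z`. -/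
structure IsSquareCorner (z a b : ℤ × ℤ) : Prop where
  left : PixelAdj .four z a
  right : PixelAdj .four z b
  diag : PixelAdj .eight a b

/-- The affine function that vanishes on the line `ab` and takes the values `-1` at `z` and `1` at
`a + b - z` when `a` and `b` are the neighbours of `z` in a unit square. -/
def cornerSide (z a b : ℤ × ℤ) (x : ℝ × ℝ) : ℝ :=
  (x.1 - z.1) * (a.1 + b.1 - 2 * z.1) + (x.2 - z.2) * (a.2 + b.2 - 2 * z.2) - 1

section Corner

variable {z w a b a' b' : ℤ × ℤ} {x y : ℝ × ℝ}

theorem IsSquareCorner.exists_signs (h : IsSquareCorner z a b) : ∃ s t : ℤ, (s = 1 ∨ s = -1) ∧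
    (t = 1 ∨ t = -1) ∧ ((a = (z.1 + s, z.2) ∧ b = (z.1, z.2 + t)) ∨
      (b = (z.1 + s, z.2) ∧ a = (z.1, z.2 + t))) := by
  refine ⟨a.1 + b.1 - 2 * z.1, a.2 + b.2 - 2 * z.2, ?_⟩
  obtain ⟨hza, hzb, hab⟩ := h
  simp only [pixelAdj_four_iff, pixelAdj_eight_iff, ne_eq, Prod.ext_iff, abs_le] at *
  omega

theorem IsSquareCorner.symm (h : IsSquareCorner z a b) : IsSquareCorner z b a :=
  ⟨h.right, h.left, h.diag.symm⟩

theorem IsSquareCorner.opposite (h : IsSquareCorner z a b) : IsSquareCorner (a + b - z) a b := by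
  obtain ⟨hza, hzb, hab⟩ := h
  refine ⟨?_, ?_, hab⟩ <;>
    simp only [pixelAdj_four_iff, pixelAdj_eight_iff, ne_eq, Prod.ext_iff, abs_le, Prod.fst_add,
      Prod.snd_add, Prod.fst_sub, Prod.snd_sub] at * <;>
    omega

theorem IsSquareCorner.not_pixelAdj_four (h : IsSquareCorner z a b) : ¬PixelAdj .four a b := by
  obtain ⟨hza, hzb, -⟩ := h
  rw [pixelAdj_four_iff] at *
  omega

theorem pixelAdj_four_or_isSquareCorner (h : PixelAdj .eight z w) :
    PixelAdj .four z w ∨ ∃ a b, IsSquareCorner z a b ∧ w = a + b - z := by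
  by_cases hzw : PixelAdj .four z w
  · exact .inl hzw
  refine .inr ⟨(w.1, z.2), (z.1, w.2), ?_, by ext <;> simp⟩
  simp only [pixelAdj_four_iff, pixelAdj_eight_iff, ne_eq, Prod.ext_iff, abs_le] at h hzw
  constructor <;>
    simp only [pixelAdj_four_iff, pixelAdj_eight_iff, ne_eq, Prod.ext_iff, abs_le,
      true_and] <;>
    omega

theorem IsSquareCorner.cornerSide_opposite (h : IsSquareCorner z a b) (x : ℝ × ℝ) :
    cornerSide (a + b - z) a b x = -cornerSide z a b x := by
  obtain ⟨s, t, rfl | rfl, rfl | rfl, ⟨rfl, rfl⟩ | ⟨rfl, rfl⟩⟩ := h.exists_signs <;>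
    simp [cornerSide] <;> ring

theorem IsSquareCorner.mem_segment (h : IsSquareCorner z a b) (hx : dist x (toPlane z) < 1)
    (hside : cornerSide z a b x = 0) : x ∈ segment ℝ (toPlane a) (toPlane b) := by
  rw [dist_toPlane_lt_one, abs_lt, abs_lt] at hx
  obtain ⟨s, t, hs, ht, hab⟩ := h.exists_signs
  wlog hab' : a = (z.1 + s, z.2) ∧ b = (z.1, z.2 + t) generalizing a b
  · rw [segment_symm]
    refine this h.symm ?_ hab.symm (hab.resolve_left hab')
    rw [← hside, cornerSide, cornerSide, add_comm (a.1 : ℝ), add_comm (a.2 : ℝ)]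
  obtain ⟨rfl, rfl⟩ := hab'
  refine mem_segment_prod_iff.2 ⟨(x.2 - z.2) * t, ?_⟩
  rcases hs with rfl | rfl <;> rcases ht with rfl | rfl <;>
    simp only [cornerSide, toPlane, Set.mem_Icc] at hside ⊢ <;> push_cast at hside ⊢ <;>
    refine ⟨⟨?_, ?_⟩, ?_, ?_⟩ <;> linarith

theorem IsSquareCorner.cornerSide_eq_zero (h : IsSquareCorner z a b)
    (hy : y ∈ segment ℝ (toPlane a) (toPlane b)) : cornerSide z a b y = 0 := by
  obtain ⟨θ, -, hy₁, hy₂⟩ := mem_segment_prod_iff.1 hy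
  obtain ⟨s, t, rfl | rfl, rfl | rfl, ⟨rfl, rfl⟩ | ⟨rfl, rfl⟩⟩ := h.exists_signs <;>
    simp [cornerSide, hy₁, hy₂, toPlane] <;> ring

theorem cornerSide_lineMap_self {θ : ℝ} (h₁ : y.1 = x.1 + θ * ((toPlane z).1 - x.1))
    (h₂ : y.2 = x.2 + θ * ((toPlane z).2 - x.2)) :
    cornerSide z a b y + 1 = (1 - θ) * (cornerSide z a b x + 1) := by
  simp only [cornerSide, toPlane, h₁, h₂]
  ring

theorem IsSquareCorner.cornerSide_nonneg (h : IsSquareCorner z a b)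
    (hyx : y ∈ segment ℝ x (toPlane z)) (hy : y ∈ segment ℝ (toPlane a) (toPlane b)) :
    0 ≤ cornerSide z a b x := by
  obtain ⟨θ, ⟨hθ₀, hθ₁⟩, hy₁, hy₂⟩ := mem_segment_prod_iff.1 hyx
  have hone := cornerSide_lineMap_self (a := a) (b := b) hy₁ hy₂
  rw [h.cornerSide_eq_zero hy, zero_add] at hone
  have hlt : 0 < 1 - θ := (sub_nonneg.2 hθ₁).lt_of_ne fun h0 => by simp [← h0] at hone
  exact nonneg_of_mul_nonneg_right (by linarith : 0 ≤ (1 - θ) * cornerSide z a b x) hlt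

theorem IsSquareCorner.segment_inter_nonempty (h : IsSquareCorner z a b)
    (hx : dist x (toPlane z) < 1) (hside : 0 ≤ cornerSide z a b x) :
    (segment ℝ x (toPlane z) ∩ segment ℝ (toPlane a) (toPlane b)).Nonempty := by
  set c := cornerSide z a b x
  have hpos : 0 < c + 1 := by linarith
  let θ := c / (c + 1)
  let y : ℝ × ℝ := (x.1 + θ * ((toPlane z).1 - x.1), x.2 + θ * ((toPlane z).2 - x.2))
  have hyx : y ∈ segment ℝ x (toPlane z) := mem_segment_prod_iff.2
    ⟨θ, ⟨div_nonneg hside hpos.le, (div_le_one hpos).2 (by linarith)⟩, rfl, rfl⟩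
  refine ⟨y, hyx, h.mem_segment ?_ ?_⟩
  · exact (convex_ball _ _).segment_subset hx (Metric.mem_ball_self one_pos) hyx
  · have : cornerSide z a b y + 1 = (1 - θ) * (c + 1) := cornerSide_lineMap_self rfl rfl
    have : (1 - θ) * (c + 1) = 1 := by simp only [θ]; field_simp; ring
    linarith

theorem IsSquareCorner.dist_opposite_lt_one (h : IsSquareCorner z a b)
    (hx : dist x (toPlane z) < 1) (hside : 0 ≤ cornerSide z a b x) :
    dist x (toPlane (a + b - z)) < 1 := by
  rw [dist_toPlane_lt_one, abs_lt, abs_lt] at *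
  obtain ⟨s, t, rfl | rfl, rfl | rfl, ⟨rfl, rfl⟩ | ⟨rfl, rfl⟩⟩ := h.exists_signs <;>
    simp only [cornerSide, Prod.fst_add, Prod.fst_sub, Prod.snd_add, Prod.snd_sub] at hside ⊢ <;>
    push_cast at hside ⊢ <;> refine ⟨⟨?_, ?_⟩, ?_, ?_⟩ <;> linarith

theorem abs_sub_lt_two_of_dist_lt_one (hz : dist x (toPlane z) < 1) (hw : dist x (toPlane w) < 1) :
    |z.1 - w.1| < 2 ∧ |z.2 - w.2| < 2 := by
  rw [dist_toPlane_lt_one, abs_lt, abs_lt] at *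
  refine ⟨⟨?_, ?_⟩, ?_, ?_⟩ <;> rify <;> linarith

theorem IsSquareCorner.opposite_eq (h : IsSquareCorner z a b)
    (h' : IsSquareCorner (a + b - z) a' b') (hz : dist x (toPlane z) < 1)
    (hopp : dist x (toPlane (a' + b' - (a + b - z))) < 1) :
    a' + b' = a + b := by
  have hdist := abs_sub_lt_two_of_dist_lt_one hz hopp
  obtain ⟨s, t, hs, ht, hab⟩ := h.exists_signs
  obtain ⟨s', t', hs', ht', hab'⟩ := h'.exists_signs
  simp only [Prod.ext_iff, abs_lt, Prod.fst_add, Prod.fst_sub, Prod.snd_add, Prod.snd_sub] at *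
  omega

end Corner

section LatticeSegments

variable {a b u v z : ℤ × ℤ} {y : ℝ × ℝ}

theorem eq_or_eq_of_abs_sub_lt_one {m n k : ℤ} {r t : ℝ} (hmn : |m - n| ≤ 1)
    (ht : t ∈ Set.Icc (0 : ℝ) 1) (hr : r = m + t * (n - m)) (hk : |r - k| < 1) :
    k = m ∨ k = n := by
  have hlo : min m n - 1 < k := by
    rify
    rcases le_total (m : ℝ) n with h | h
    · rw [min_eq_left h]
      nlinarith [mul_nonneg ht.1 (sub_nonneg.2 h), (abs_lt.1 hk).2]
    · rw [min_eq_right h]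
      nlinarith [mul_nonneg (sub_nonneg.2 ht.2) (sub_nonneg.2 h), (abs_lt.1 hk).2]
  have hhi : k < max m n + 1 := by
    rify
    rcases le_total (m : ℝ) n with h | h
    · rw [max_eq_right h]
      nlinarith [mul_nonneg (sub_nonneg.2 ht.2) (sub_nonneg.2 h), (abs_lt.1 hk).1]
    · rw [max_eq_left h]
      nlinarith [mul_nonneg ht.1 (sub_nonneg.2 h), (abs_lt.1 hk).1]
  rw [abs_le] at hmn
  omega

theorem isSquareCorner_of_dist_lt_one (hab : a = b ∨ PixelAdj .eight a b)
    (hy : y ∈ segment ℝ (toPlane a) (toPlane b)) (hz : dist y (toPlane z) < 1) (hza : z ≠ a)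
    (hzb : z ≠ b) : IsSquareCorner z a b := by
  have habs : |a.1 - b.1| ≤ 1 ∧ |a.2 - b.2| ≤ 1 := by
    rcases hab with rfl | hab
    · simp
    · exact (pixelAdj_eight_iff.1 hab).2
  obtain ⟨t, ht, hy₁, hy₂⟩ := mem_segment_prod_iff.1 hy
  obtain ⟨hz₁, hz₂⟩ := dist_toPlane_lt_one.1 hz
  have h₁ := eq_or_eq_of_abs_sub_lt_one habs.1 ht hy₁ hz₁
  have h₂ := eq_or_eq_of_abs_sub_lt_one habs.2 ht hy₂ hz₂
  rw [abs_le, abs_le] at habs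
  constructor <;>
    simp only [pixelAdj_four_iff, pixelAdj_eight_iff, ne_eq, Prod.ext_iff, abs_le] at * <;>
    omega

theorem eq_or_eq_of_dist_lt_one (hab : a = b ∨ PixelAdj .four a b)
    (hy : y ∈ segment ℝ (toPlane a) (toPlane b)) (hz : dist y (toPlane z) < 1) :
    z = a ∨ z = b := by
  by_contra! h
  have hcorner := isSquareCorner_of_dist_lt_one (hab.imp_right .of_four) hy hz h.1 h.2
  exact hab.elim hcorner.diag.ne hcorner.not_pixelAdj_four

theorem dist_lt_one_or_of_mem_segment (hab : a = b ∨ PixelAdj .eight a b)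
    (hy : y ∈ segment ℝ (toPlane a) (toPlane b)) :
    dist y (toPlane a) < 1 ∨ dist y (toPlane b) < 1 := by
  have hdist : dist (toPlane a) (toPlane b) ≤ 1 := by
    rcases hab with rfl | hab
    · simp
    · obtain ⟨-, h₁, h₂⟩ := pixelAdj_eight_iff.1 hab
      rw [Prod.dist_eq, Real.dist_eq, Real.dist_eq]
      exact max_le (by simp only [toPlane]; exact_mod_cast h₁)
        (by simp only [toPlane]; exact_mod_cast h₂)
  have := dist_add_dist_of_mem_segment hy
  by_contra! h
  rw [dist_comm (toPlane a)] at this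
  linarith

theorem disjoint_segment_of_dual {α : Connectivity} (huv : PixelAdj α u v)
    (hab : a = b ∨ PixelAdj α.dual a b) (hau : a ≠ u) (hav : a ≠ v) (hbu : b ≠ u) (hbv : b ≠ v) :
    Disjoint (segment ℝ (toPlane u) (toPlane v)) (segment ℝ (toPlane a) (toPlane b)) := by
  refine Set.disjoint_left.2 fun y hyuv hyab => ?_
  cases α
  · rcases dist_lt_one_or_of_mem_segment hab hyab with h | h
    · exact (eq_or_eq_of_dist_lt_one (.inr huv) hyuv h).elim hau hav
    · exact (eq_or_eq_of_dist_lt_one (.inr huv) hyuv h).elim hbu hbv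
  · rcases dist_lt_one_or_of_mem_segment (.inr huv) hyuv with h | h
    · exact (eq_or_eq_of_dist_lt_one hab hyab h).elim hau.symm hbu.symm
    · exact (eq_or_eq_of_dist_lt_one hab hyab h).elim hav.symm hbv.symm

end LatticeSegments

/-! ### The region enclosed by the polygon -/

/-- The points at `ℓ_∞`-distance less than `1` from a pixel of `S` that they see past the polygon of
`T`. Off the polygon, these sets for the interior pixels and for the exterior pixels separate the
inside from the outside. -/
def visibleRegion (α : Connectivity) (T S : Set (ℤ × ℤ)) : Set (ℝ × ℝ) :=
  {x | ∃ z ∈ S, dist x (toPlane z) < 1 ∧ segment ℝ x (toPlane z) ⊆ (boundaryPolygon α T)ᶜ}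

section Polygon

variable {α : Connectivity} {T : Set (ℤ × ℤ)} {a b u v z : ℤ × ℤ} {x y : ℝ × ℝ}

theorem mem_boundaryPolygon : x ∈ boundaryPolygon α T ↔
    ∃ u ∈ exteriorSitePerimeter α T, ∃ v ∈ exteriorSitePerimeter α T,
      (u = v ∨ PixelAdj α.dual u v) ∧ x ∈ segment ℝ (toPlane u) (toPlane v) := by
  have hadj : ∀ u ∈ exteriorSitePerimeter α T, ∀ v ∈ exteriorSitePerimeter α T,
      (charGraph α T).Adj u v ↔ PixelAdj α.dual u v := fun u hu v hv => by
    simp [charGraph, BinaryImage.graph, white_charImage, black_charImage, hu.1, hv.1]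
  constructor
  · rintro (⟨u, hu, rfl⟩ | ⟨u, hu, v, hv, huv, hx⟩)
    · exact ⟨u, hu, u, hu, .inl rfl, by simp⟩
    · exact ⟨u, hu, v, hv, .inr ((hadj u hu v hv).1 huv), hx⟩
  · rintro ⟨u, hu, v, hv, rfl | huv, hx⟩
    · rw [segment_same] at hx
      exact .inl ⟨u, hu, hx.symm⟩
    · exact .inr ⟨u, hu, v, hv, (hadj u hu v hv).2 huv, hx⟩

theorem isClosed_boundaryPolygon (hT : T.Finite) : IsClosed (boundaryPolygon α T) := by
  have hfin : (exteriorSitePerimeter α T).Finite :=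
    (finite_sitePerimeter hT).subset fun z hz => hz.1
  have heq : boundaryPolygon α T = ⋃ u ∈ exteriorSitePerimeter α T,
      ⋃ v ∈ {v ∈ exteriorSitePerimeter α T | u = v ∨ PixelAdj α.dual u v},
        segment ℝ (toPlane u) (toPlane v) := by
    ext x
    simp only [mem_boundaryPolygon, Set.mem_iUnion, Set.mem_ofPred_eq, exists_prop, and_assoc]
  rw [heq]
  exact hfin.isClosed_biUnion fun u _ => (hfin.subset (Set.sep_subset _ _)).isClosed_biUnion
    fun v _ => (isCompact_segment _ _).isClosed

theorem segment_subset_compl_boundaryPolygon (huv : PixelAdj α u v)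
    (hu : u ∉ exteriorSitePerimeter α T) (hv : v ∉ exteriorSitePerimeter α T) :
    segment ℝ (toPlane u) (toPlane v) ⊆ (boundaryPolygon α T)ᶜ := by
  intro y hyuv hy
  obtain ⟨a, ha, b, hb, hab, hyab⟩ := mem_boundaryPolygon.1 hy
  exact Set.disjoint_left.1 (disjoint_segment_of_dual huv hab (ne_of_mem_of_not_mem ha hu)
    (ne_of_mem_of_not_mem ha hv) (ne_of_mem_of_not_mem hb hu) (ne_of_mem_of_not_mem hb hv))
    hyuv hyab

theorem exists_isSquareCorner_of_mem_boundaryPolygon (hy : y ∈ boundaryPolygon α T)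
    (hyz : dist y (toPlane z) < 1) (hz : z ∉ exteriorSitePerimeter α T) :
    α = .four ∧ ∃ a ∈ exteriorSitePerimeter α T, ∃ b ∈ exteriorSitePerimeter α T,
      IsSquareCorner z a b ∧ y ∈ segment ℝ (toPlane a) (toPlane b) := by
  obtain ⟨a, ha, b, hb, hab, hyab⟩ := mem_boundaryPolygon.1 hy
  have hcorner := isSquareCorner_of_dist_lt_one (hab.imp_right PixelAdj.to_eight) hyab hyz
    (ne_of_mem_of_not_mem ha hz).symm (ne_of_mem_of_not_mem hb hz).symm
  refine ⟨?_, a, ha, b, hb, hcorner, hyab⟩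
  cases α
  · rfl
  · exact absurd hab (not_or.2 ⟨hcorner.diag.ne, hcorner.not_pixelAdj_four⟩)

theorem not_forall_mem_exteriorSitePerimeter {c : Fin 3 → ℤ × ℤ} (hT : T.Finite)
    (hconn : PixelConnected α T) (hc : Pairwise fun i j => PixelAdj .eight (c i) (c j))
    (hfourth : α = .eight → ∀ d, (∀ i, PixelAdj .eight d (c i)) → d ∈ exteriorSitePerimeter α T) :
    ¬∀ i, c i ∈ exteriorSitePerimeter α T := fun h =>
  not_touchesTriangle hT hconn (disjoint_exteriorRegion_self hT)
    (fun _ hx _ hy => not_pixelAdj_exteriorRegion hT hx hy)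
    (fun _ he => infinite_reachable_exteriorRegion he) hc
    ⟨fun i => (h i).1.1, fun i => (h i).1.2, fun hα d hd => (hfourth hα d hd).1.1⟩
    ⟨fun i hi => (mem_exteriorRegion.1 hi).1 (h i).1, fun i => (h i).2,
      fun hα d hd hdE => (mem_exteriorRegion.1 hdE).1 (hfourth hα d hd).1⟩

theorem IsSquareCorner.eq_opposite {d : ℤ × ℤ} (h : IsSquareCorner z a b)
    (hdz : PixelAdj .eight d z) (hda : PixelAdj .eight d a) (hdb : PixelAdj .eight d b) :
    d = a + b - z := by
  obtain ⟨s, t, hs, ht, hab⟩ := h.exists_signs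
  simp only [pixelAdj_eight_iff, ne_eq, Prod.ext_iff, abs_le, Prod.fst_add, Prod.snd_add,
    Prod.fst_sub, Prod.snd_sub] at *
  omega

theorem IsSquareCorner.pairwise_adj (h : IsSquareCorner z a b) :
    Pairwise fun i j => PixelAdj .eight (![z, a, b] i) (![z, a, b] j) := by
  have := h.left.of_four (α := .eight)
  have := h.right.of_four (α := .eight)
  have := h.diag
  intro i j hij
  fin_cases i <;> fin_cases j <;>
    first | exact absurd rfl hij | assumption | (apply PixelAdj.symm; assumption)

theorem IsSquareCorner.notMem_exteriorSitePerimeter (h : IsSquareCorner z a b) (hT : T.Finite)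
    (hconn : PixelConnected .four T) (ha : a ∈ exteriorSitePerimeter .four T)
    (hb : b ∈ exteriorSitePerimeter .four T) : z ∉ exteriorSitePerimeter .four T := by
  intro hz
  refine not_forall_mem_exteriorSitePerimeter hT hconn h.pairwise_adj (by simp) fun i => ?_
  fin_cases i <;> assumption

theorem IsSquareCorner.exists_notMem_exteriorSitePerimeter (h : IsSquareCorner z a b)
    (hT : T.Finite) (hconn : PixelConnected α T) :
    ∃ w, (w = z ∨ w = a ∨ w = b ∨ w = a + b - z) ∧ w ∉ exteriorSitePerimeter α T := by
  by_contra! hmem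
  refine not_forall_mem_exteriorSitePerimeter hT hconn h.pairwise_adj (fun _ d hd => ?_) fun i => ?_
  · exact hmem d (.inr (.inr (.inr (h.eq_opposite (hd 0) (hd 1) (hd 2)))))
  · fin_cases i <;> apply hmem <;> simp

end Polygon

section Visibility

variable {α : Connectivity} {S T : Set (ℤ × ℤ)} {a b z : ℤ × ℤ} {x : ℝ × ℝ}

theorem notMem_or_notMem_of_mem_segment (hab : a = b ∨ PixelAdj α.dual a b)
    (hx : x ∈ segment ℝ (toPlane a) (toPlane b)) (hxP : x ∉ boundaryPolygon α T) :
    a ∉ exteriorSitePerimeter α T ∨ b ∉ exteriorSitePerimeter α T := by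
  by_contra! h
  exact hxP (mem_boundaryPolygon.2 ⟨a, h.1, b, h.2, hab, hx⟩)

theorem exists_notMem_exteriorSitePerimeter_dist_lt_one (hT : T.Finite)
    (hconn : PixelConnected α T) (hx : x ∉ boundaryPolygon α T) :
    ∃ z ∉ exteriorSitePerimeter α T, dist x (toPlane z) < 1 := by
  simp only [dist_toPlane_lt_one, abs_lt]
  obtain ⟨m, hm, hm'⟩ : ∃ m : ℤ, (m : ℝ) ≤ x.1 ∧ x.1 < m + 1 :=
    ⟨⌊x.1⌋, Int.floor_le _, Int.lt_floor_add_one _⟩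
  obtain ⟨n, hn, hn'⟩ : ∃ n : ℤ, (n : ℝ) ≤ x.2 ∧ x.2 < n + 1 :=
    ⟨⌊x.2⌋, Int.floor_le _, Int.lt_floor_add_one _⟩
  rcases hm.eq_or_lt with hm | hm <;> rcases hn.eq_or_lt with hn | hn
  · refine ⟨(m, n), fun h => hx (mem_boundaryPolygon.2 ⟨_, h, _, h, .inl rfl, ?_⟩), ?_⟩
    · simp [toPlane, hm, hn]
    · simp [hm, hn]
  · have hadj : PixelAdj .four (m, n) (m, n + 1) := by simp [pixelAdj_four_iff]
    have hseg : x ∈ segment ℝ (toPlane (m, n)) (toPlane (m, n + 1)) := mem_segment_prod_iff.2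
      ⟨x.2 - n, ⟨by linarith, by linarith⟩, by simp [toPlane, hm], by simp [toPlane]⟩
    rcases notMem_or_notMem_of_mem_segment (.inr hadj.of_four) hseg hx with h | h <;>
      refine ⟨_, h, ⟨?_, ?_⟩, ?_, ?_⟩ <;> push_cast <;> linarith
  · have hadj : PixelAdj .four (m, n) (m + 1, n) := by simp [pixelAdj_four_iff]
    have hseg : x ∈ segment ℝ (toPlane (m, n)) (toPlane (m + 1, n)) := mem_segment_prod_iff.2
      ⟨x.1 - m, ⟨by linarith, by linarith⟩, by simp [toPlane], by simp [toPlane, hn]⟩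
    rcases notMem_or_notMem_of_mem_segment (.inr hadj.of_four) hseg hx with h | h <;>
      refine ⟨_, h, ⟨?_, ?_⟩, ?_, ?_⟩ <;> push_cast <;> linarith
  · have hcorner : IsSquareCorner (m, n) (m + 1, n) (m, n + 1) := by
      constructor <;> simp [pixelAdj_four_iff, pixelAdj_eight_iff]
    obtain ⟨w, hw, hwP⟩ := hcorner.exists_notMem_exteriorSitePerimeter hT hconn
    refine ⟨w, hwP, ?_⟩
    rcases hw with rfl | rfl | rfl | rfl <;> refine ⟨⟨?_, ?_⟩, ?_, ?_⟩ <;>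
      simp only [Prod.fst_add, Prod.snd_add, Prod.fst_sub, Prod.snd_sub] <;> push_cast <;> linarith

theorem exists_isSquareCorner_of_not_visible (hz : z ∉ exteriorSitePerimeter α T)
    (hxz : dist x (toPlane z) < 1) (hvis : ¬segment ℝ x (toPlane z) ⊆ (boundaryPolygon α T)ᶜ) :
    α = .four ∧ ∃ a ∈ exteriorSitePerimeter α T, ∃ b ∈ exteriorSitePerimeter α T,
      IsSquareCorner z a b ∧ 0 ≤ cornerSide z a b x := by
  obtain ⟨y, hyx, hy⟩ := Set.not_subset.1 hvis
  have hyz : dist y (toPlane z) < 1 :=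
    (convex_ball _ _).segment_subset hxz (Metric.mem_ball_self one_pos) hyx
  obtain ⟨hα, a, ha, b, hb, hcorner, hyab⟩ :=
    exists_isSquareCorner_of_mem_boundaryPolygon (not_not.1 hy) hyz hz
  exact ⟨hα, a, ha, b, hb, hcorner, hcorner.cornerSide_nonneg hyx hyab⟩

/-- If a diagonal of the polygon hides a pixel from `x`, then the opposite corner of its unit square
is visible from `x`. -/
theorem compl_boundaryPolygon_subset_visibleRegion (hT : T.Finite) (hconn : PixelConnected α T) :
    (boundaryPolygon α T)ᶜ ⊆ visibleRegion α T (exteriorSitePerimeter α T)ᶜ := by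
  intro x hx
  obtain ⟨z, hz, hxz⟩ := exists_notMem_exteriorSitePerimeter_dist_lt_one hT hconn hx
  by_cases hvis : segment ℝ x (toPlane z) ⊆ (boundaryPolygon α T)ᶜ
  · exact ⟨z, hz, hxz, hvis⟩
  obtain ⟨rfl, a, ha, b, hb, h, hside⟩ := exists_isSquareCorner_of_not_visible hz hxz hvis
  have hopp : a + b - z ∉ exteriorSitePerimeter .four T :=
    h.opposite.notMem_exteriorSitePerimeter hT hconn ha hb
  have hxopp := h.dist_opposite_lt_one hxz hside
  refine ⟨a + b - z, hopp, hxopp, ?_⟩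
  by_contra hvis'
  obtain ⟨-, a', -, b', -, h', hside'⟩ := exists_isSquareCorner_of_not_visible hopp hxopp hvis'
  have hsum : a' + b' = a + b := h.opposite_eq h' hxz (h'.dist_opposite_lt_one hxopp hside')
  have hside_eq : cornerSide (a + b - z) a' b' x = -cornerSide z a b x := by
    rw [← h.cornerSide_opposite, cornerSide, cornerSide]
    have h₁ : (a'.1 + b'.1 : ℝ) = a.1 + b.1 := mod_cast congrArg Prod.fst hsum
    have h₂ : (a'.2 + b'.2 : ℝ) = a.2 + b.2 := mod_cast congrArg Prod.snd hsum
    rw [h₁, h₂]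
  have hxab := h.mem_segment hxz (by linarith)
  exact hx (mem_boundaryPolygon.2 ⟨a, ha, b, hb, .inr h.diag, hxab⟩)

theorem visibleRegion_subset_compl : visibleRegion α T S ⊆ (boundaryPolygon α T)ᶜ :=
  fun x ⟨_, _, _, hvis⟩ => hvis (left_mem_segment ℝ x _)

theorem isOpen_visibleRegion (hT : T.Finite) : IsOpen (visibleRegion α T S) := by
  have heq : visibleRegion α T S = ⋃ z ∈ S, Metric.ball (toPlane z) 1 ∩
      {x | segment ℝ x (toPlane z) ⊆ (boundaryPolygon α T)ᶜ} := by
    ext x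
    simp only [visibleRegion, Set.mem_ofPred_eq, Set.mem_iUnion, Set.mem_inter_iff, Metric.mem_ball,
      exists_prop]
  rw [heq]
  exact isOpen_biUnion fun z _ => Metric.isOpen_ball.inter
    (isOpen_setOf_segment_subset (isClosed_boundaryPolygon hT).isOpen_compl _)

theorem isBounded_visibleRegion (hS : S.Finite) : Bornology.IsBounded (visibleRegion α T S) :=
  ((Bornology.isBounded_biUnion hS).2 fun _ _ => Metric.isBounded_ball).subset
    fun _ ⟨z, hz, hxz, _⟩ => Set.mem_biUnion (x := z) hz hxz

theorem disjoint_visibleRegion : Disjoint (visibleRegion α T (interiorPixels α T))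
    (visibleRegion α T (exteriorRegion α T)) := by
  rw [Set.disjoint_left]
  rintro x ⟨z, hz, hxz, hvisz⟩ ⟨w, hw, hxw, hvisw⟩
  have hzw : PixelAdj .eight z w := by
    refine pixelAdj_eight_iff.2 ⟨?_, ?_⟩
    · rintro rfl
      exact hz (.inl hw)
    · have := abs_sub_lt_two_of_dist_lt_one hxz hxw
      omega
  have hnot : ¬PixelAdj α z w := fun h => notMem_interiorPixels_of_adj hw h.symm hz
  cases α
  case eight => exact hnot hzw
  case four =>
    obtain ⟨a, b, h, rfl⟩ := (pixelAdj_four_or_isSquareCorner hzw).resolve_left hnot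
    have ha := mem_exteriorSitePerimeter_of_adj hz h.left
      (notMem_interiorPixels_of_adj hw h.opposite.left)
    have hb := mem_exteriorSitePerimeter_of_adj hz h.right
      (notMem_interiorPixels_of_adj hw h.opposite.right)
    have hblock : segment ℝ (toPlane a) (toPlane b) ⊆ boundaryPolygon .four T :=
      fun y hy => mem_boundaryPolygon.2 ⟨a, ha, b, hb, .inr h.diag, hy⟩
    rcases le_total 0 (cornerSide z a b x) with hside | hside
    · obtain ⟨y, hyz, hyab⟩ := h.segment_inter_nonempty hxz hside
      exact hvisz hyz (hblock hyab)
    · rw [← neg_nonneg, ← h.cornerSide_opposite] at hside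
      obtain ⟨y, hyw, hyab⟩ := h.opposite.segment_inter_nonempty hxw hside
      exact hvisw hyw (hblock hyab)

theorem toPlane_notMem_boundaryPolygon (hz : z ∉ exteriorSitePerimeter α T) :
    toPlane z ∉ boundaryPolygon α T := by
  intro hzP
  obtain ⟨-, a, -, b, -, h, hzab⟩ :=
    exists_isSquareCorner_of_mem_boundaryPolygon hzP (by simp) hz
  simpa [cornerSide, toPlane] using h.cornerSide_eq_zero hzab

theorem finite_preimage_toPlane {s : Set (ℝ × ℝ)} (hs : Bornology.IsBounded s) :
    (toPlane ⁻¹' s).Finite := by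
  obtain ⟨R, hR⟩ := hs.exists_norm_le
  refine finite_of_abs_le (N := ⌈R⌉) fun z hz => ?_
  have hle : |(z.1 : ℝ)| ≤ R ∧ |(z.2 : ℝ)| ≤ R := max_le_iff.1 (hR _ hz)
  have := Int.le_ceil R
  constructor <;> rify <;> linarith

theorem compl_boundaryPolygon_subset_union (hT : T.Finite) (hconn : PixelConnected α T) :
    (boundaryPolygon α T)ᶜ ⊆
      visibleRegion α T (interiorPixels α T) ∪ visibleRegion α T (exteriorRegion α T) := by
  intro x hx
  obtain ⟨z, hz, hxz, hvis⟩ := compl_boundaryPolygon_subset_visibleRegion hT hconn hx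
  by_cases hzE : z ∈ exteriorRegion α T
  · exact .inr ⟨z, hzE, hxz, hvis⟩
  · exact .inl ⟨z, not_or.2 ⟨hzE, hz⟩, hxz, hvis⟩

theorem not_isBounded_connectedComponentIn (hx : x ∈ visibleRegion α T (exteriorRegion α T)) :
    ¬Bornology.IsBounded (connectedComponentIn (boundaryPolygon α T)ᶜ x) := by
  have hxP := visibleRegion_subset_compl hx
  obtain ⟨z, hz, -, hvis⟩ := hx
  have hnot : ∀ w ∈ exteriorRegion α T, w ∉ exteriorSitePerimeter α T :=
    fun w hw hwP => (mem_exteriorRegion.1 hw).1 hwP.1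
  have hreach : ∀ w, (pixelGraph α (exteriorRegion α T)).Reachable z w →
      toPlane w ∈ connectedComponentIn (boundaryPolygon α T)ᶜ x := fun w hw =>
    reachable_pixelGraph_induction (p := fun w => toPlane w ∈ connectedComponentIn _ x) hw
      (mem_connectedComponentIn_of_segment (mem_connectedComponentIn hxP) hvis)
      fun a ha b hb hab h => mem_connectedComponentIn_of_segment h
        (segment_subset_compl_boundaryPolygon hab (hnot a ha) (hnot b hb))
  exact fun hbdd => infinite_reachable_exteriorRegion hz
    ((finite_preimage_toPlane hbdd).subset hreach)

theorem polygonRegion_eq_visibleRegion (hT : T.Finite) (hconn : PixelConnected α T) :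
    polygonRegion α T = visibleRegion α T (interiorPixels α T) := by
  refine Set.Subset.antisymm (fun x hx => ?_) fun x hx => ?_
  · exact (compl_boundaryPolygon_subset_union hT hconn hx.1).resolve_right
      fun h => not_isBounded_connectedComponentIn h hx.2
  · have hxP := visibleRegion_subset_compl hx
    have hsub : connectedComponentIn (boundaryPolygon α T)ᶜ x ⊆
        visibleRegion α T (interiorPixels α T) :=
      isPreconnected_connectedComponentIn.subset_left_of_subset_union
        (isOpen_visibleRegion hT) (isOpen_visibleRegion hT) disjoint_visibleRegion
        ((connectedComponentIn_subset _ _).trans (compl_boundaryPolygon_subset_union hT hconn))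
        ⟨x, mem_connectedComponentIn hxP, hx⟩
    exact ⟨hxP, (isBounded_visibleRegion (finite_interiorPixels hT)).subset hsub⟩

theorem latticeRegion_eq_interiorPixels (hT : T.Finite) (hconn : PixelConnected α T) :
    latticeRegion α T = interiorPixels α T := by
  ext z
  rw [latticeRegion, Set.mem_preimage, polygonRegion_eq_visibleRegion hT hconn]
  constructor
  · rintro ⟨w, hw, hzw, -⟩
    rwa [eq_or_eq_of_dist_lt_one (a := z) (.inl rfl) (by simp) hzw |>.elim id id] at hw
  · intro hz
    refine ⟨z, hz, by simp, ?_⟩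
    rw [segment_same, Set.singleton_subset_iff]
    exact toPlane_notMem_boundaryPolygon fun hzP => hz (.inr hzP)

end Visibility

/-! ### Tiles -/

section Tiles

variable {α : Connectivity} {T₁ T₂ : Set (ℤ × ℤ)} {z : ℤ × ℤ} {x : ℝ × ℝ}

theorem notMem_interiorPixels_of_mem_sitePerimeter (h : T₂ ⊆ exteriorRegion α T₁)
    (hz : z ∈ sitePerimeter α T₂) : z ∉ interiorPixels α T₁ := by
  obtain ⟨-, t, ht, hzt⟩ := hz
  exact notMem_interiorPixels_of_adj (h ht) hzt.symm

theorem disjoint_boundaryPolygon_polygonRegion (hfin : T₁.Finite) (hconn : PixelConnected α T₁)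
    (h : T₂ ⊆ exteriorRegion α T₁) : Disjoint (boundaryPolygon α T₂) (polygonRegion α T₁) := by
  rw [polygonRegion_eq_visibleRegion hfin hconn, Set.disjoint_left]
  rintro y hy ⟨z, hz, hyz, hvis⟩
  have hnot : ∀ v ∈ exteriorSitePerimeter α T₂, v ∉ interiorPixels α T₁ :=
    fun v hv => notMem_interiorPixels_of_mem_sitePerimeter h hv.1
  obtain ⟨rfl, a, ha, b, hb, hcorner, hyab⟩ :=
    exists_isSquareCorner_of_mem_boundaryPolygon hy hyz fun hzP => hnot z hzP hz
  have ha₁ := mem_exteriorSitePerimeter_of_adj hz hcorner.left (hnot a ha)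
  have hb₁ := mem_exteriorSitePerimeter_of_adj hz hcorner.right (hnot b hb)
  exact hvis (left_mem_segment ℝ y _)
    (mem_boundaryPolygon.2 ⟨a, ha₁, b, hb₁, .inr hcorner.diag, hyab⟩)

theorem boundaryPolygon_mono (h : exteriorSitePerimeter α T₁ ⊆ exteriorSitePerimeter α T₂) :
    boundaryPolygon α T₁ ⊆ boundaryPolygon α T₂ := by
  intro y hy
  obtain ⟨a, ha, b, hb, hab, hyab⟩ := mem_boundaryPolygon.1 hy
  exact mem_boundaryPolygon.2 ⟨a, h ha, b, h hb, hab, hyab⟩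

theorem mem_visibleRegion_interiorPixels_inter (hfin₁ : T₁.Finite) (hfin₂ : T₂.Finite)
    (hconn₁ : PixelConnected α T₁) (hconn₂ : PixelConnected α T₂) (h₂₁ : T₂ ⊆ exteriorRegion α T₁)
    (hx₁ : x ∈ polygonRegion α T₁) (hx₂ : x ∈ polygonRegion α T₂) :
    x ∈ visibleRegion α T₁ (interiorPixels α T₁ ∩ interiorPixels α T₂) := by
  have hdisj := disjoint_boundaryPolygon_polygonRegion hfin₁ hconn₁ h₂₁
  rw [polygonRegion_eq_visibleRegion hfin₁ hconn₁] at hx₁ hdisj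
  obtain ⟨z, hz₁, hxz, hvis⟩ := hx₁
  have hvis₂ : segment ℝ x (toPlane z) ⊆ (boundaryPolygon α T₂)ᶜ := fun y hy hyP =>
    Set.disjoint_left.1 hdisj hyP ⟨z, hz₁,
      (convex_ball _ _).segment_subset hxz (Metric.mem_ball_self one_pos) hy,
      ((convex_segment _ _).segment_subset hy (right_mem_segment ℝ _ _)).trans hvis⟩
  have hz₂ : z ∈ latticeRegion α T₂ := by
    refine ⟨hvis₂ (right_mem_segment ℝ _ _), ?_⟩
    rw [← connectedComponentIn_eq
      (mem_connectedComponentIn_of_segment (mem_connectedComponentIn hx₂.1) hvis₂)]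
    exact hx₂.2
  rw [latticeRegion_eq_interiorPixels hfin₂ hconn₂] at hz₂
  exact ⟨z, ⟨hz₁, hz₂⟩, hxz, hvis⟩

theorem exteriorSitePerimeter_component_subset (h₂₁ : T₂ ⊆ exteriorRegion α T₁)
    (hz : z ∈ interiorPixels α T₁ ∩ interiorPixels α T₂) :
    exteriorSitePerimeter α
      {w | (pixelGraph α (interiorPixels α T₁ ∩ interiorPixels α T₂)).Reachable z w} ⊆
      exteriorSitePerimeter α T₁ := by
  rintro p ⟨⟨hpD, d, hd, hpd⟩, -⟩
  have hd' := mem_of_reachable_pixelGraph hd hz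
  have hp : ¬(p ∈ interiorPixels α T₁ ∧ p ∈ interiorPixels α T₂) := fun hp =>
    hpD (SimpleGraph.Reachable.trans hd (SimpleGraph.Adj.reachable ⟨hd', hp, hpd.symm⟩))
  refine mem_exteriorSitePerimeter_of_adj hd'.1 hpd.symm fun hp₁ => ?_
  have hp₂ := mem_exteriorSitePerimeter_of_adj hd'.2 hpd.symm fun hp₂ => hp ⟨hp₁, hp₂⟩
  exact notMem_interiorPixels_of_mem_sitePerimeter h₂₁ hp₂.1 hp₁

theorem component_mem_nestedFamily (hfin₁ : T₁.Finite) (hconn₁ : PixelConnected α T₁)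
    (h₁₂ : T₁ ⊆ exteriorRegion α T₂) (hz : z ∈ interiorPixels α T₁ ∩ interiorPixels α T₂) :
    {w | (pixelGraph α (interiorPixels α T₁ ∩ interiorPixels α T₂)).Reachable z w} ∈
      nestedFamily α T₁ := by
  refine ⟨BinaryImage.isWhiteConnected_iff.2 ⟨fun w hw => ?_, ⟨z, .rfl⟩,
    pixelConnected_component _ _ _⟩, fun w hw => ?_⟩ <;>
    obtain ⟨hw₁, hw₂⟩ := mem_of_reachable_pixelGraph hw hz
  · rw [white_charImage]
    exact fun hwP => notMem_interiorPixels_of_mem_sitePerimeter h₁₂ hwP hw₂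
  · rw [latticeRegion_eq_interiorPixels hfin₁ hconn₁]
    exact ⟨hw₁, fun hwT => hw₂ (.inl (h₁₂ hwT))⟩

/-- The component of a common interior pixel seen from a common point is nested in `T₁`, and its
polygon is part of that of `T₁`, so it encloses the point. -/
theorem disjoint_polygonalTile_polygonRegion (hfin₁ : T₁.Finite) (hfin₂ : T₂.Finite)
    (hconn₁ : PixelConnected α T₁) (hconn₂ : PixelConnected α T₂) (h₁₂ : T₁ ⊆ exteriorRegion α T₂)
    (h₂₁ : T₂ ⊆ exteriorRegion α T₁) : Disjoint (polygonalTile α T₁) (polygonRegion α T₂) := by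
  refine Set.disjoint_left.2 fun x hx₁ hx₂ => ?_
  obtain ⟨z, hz, hxz, hvis⟩ :=
    mem_visibleRegion_interiorPixels_inter hfin₁ hfin₂ hconn₁ hconn₂ h₂₁ hx₁.1 hx₂
  set D := {w | (pixelGraph α (interiorPixels α T₁ ∩ interiorPixels α T₂)).Reachable z w}
  have hDfin : D.Finite := (finite_interiorPixels hfin₁).subset
    fun w hw => (mem_of_reachable_pixelGraph hw hz).1
  refine hx₁.2 (Set.mem_biUnion (component_mem_nestedFamily hfin₁ hconn₁ h₁₂ hz) ?_)
  change x ∈ polygonRegion α D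
  rw [polygonRegion_eq_visibleRegion hDfin (pixelConnected_component _ _ _)]
  exact ⟨z, subset_interiorPixels hDfin .rfl, hxz, hvis.trans (Set.compl_subset_compl.2
    (boundaryPolygon_mono (exteriorSitePerimeter_component_subset h₂₁ hz)))⟩

theorem BinaryImage.IsWhiteComponent.mem_nestedFamily {I : BinaryImage}
    (hT₁ : I.IsWhiteComponent α T₁) (hT₂ : I.IsWhiteComponent α T₂) (hfin₁ : T₁.Finite)
    (hne : T₁ ≠ T₂) (h : ¬T₂ ⊆ exteriorRegion α T₁) : T₂ ∈ nestedFamily α T₁ := by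
  obtain ⟨-, -, hconn₁⟩ := BinaryImage.isWhiteConnected_iff.1 hT₁.prop
  obtain ⟨hwhite₂, hne₂, hconn₂⟩ := BinaryImage.isWhiteConnected_iff.1 hT₂.prop
  have hperim : Disjoint T₂ (sitePerimeter α T₁) := Set.disjoint_left.2 fun u hu hP =>
    let ⟨hu₁, _, ht, hut⟩ := hP
    hu₁ (hT₁.mem_of_adj ht (hwhite₂ hu) hut.symm)
  have hext := hconn₂.disjoint_exteriorRegion hperim h
  refine ⟨BinaryImage.isWhiteConnected_iff.2 ⟨?_, hne₂, hconn₂⟩, ?_⟩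
  · rw [white_charImage]
    exact Set.subset_compl_iff_disjoint_right.2 hperim
  · rw [latticeRegion_eq_interiorPixels hfin₁ hconn₁]
    exact fun u hu => ⟨not_or.2 ⟨Set.disjoint_left.1 hext hu,
      fun hP => Set.disjoint_left.1 hperim hu hP.1⟩,
      Set.disjoint_right.1 (hT₁.disjoint_of_ne hT₂ hne) hu⟩

end Tiles

theorem lemma6p2 (α : Connectivity) (I : BinaryImage) (T₁ T₂ : Set (ℤ × ℤ))
    (hT₁ : I.IsWhiteComponent α T₁) (hT₂ : I.IsWhiteComponent α T₂)
    (hfin₁ : T₁.Finite) (hfin₂ : T₂.Finite) (hne : T₁ ≠ T₂) :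
    polygonalTile α T₁ ∩ polygonalTile α T₂ = ∅ := by
  obtain ⟨-, -, hconn₁⟩ := BinaryImage.isWhiteConnected_iff.1 hT₁.prop
  obtain ⟨-, -, hconn₂⟩ := BinaryImage.isWhiteConnected_iff.1 hT₂.prop
  rw [← Set.disjoint_iff_inter_eq_empty]
  by_cases h₂₁ : T₂ ⊆ exteriorRegion α T₁
  · by_cases h₁₂ : T₁ ⊆ exteriorRegion α T₂
    · exact (disjoint_polygonalTile_polygonRegion hfin₁ hfin₂ hconn₁ hconn₂ h₁₂ h₂₁).mono_right
        Set.sdiff_subset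
    · have hnested := hT₂.mem_nestedFamily hT₁ hfin₂ hne.symm h₁₂
      exact Set.disjoint_left.2 fun x hx₁ hx₂ => hx₂.2 (Set.mem_biUnion hnested hx₁.1)
  · have hnested := hT₁.mem_nestedFamily hT₂ hfin₁ hne h₂₁
    exact Set.disjoint_left.2 fun x hx₁ hx₂ => hx₁.2 (Set.mem_biUnion hnested hx₂.1)
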